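/- Let $p$ be a prime, let $1\le r\le s$ be integers, and write $\mathbb Z_{m}=\mathbb Z/m\mathbb Z$. Let $\lambda\in\mathbb Z_{p^s}^\times$, let $\lambda'\in\mathbb Z_{p^r}^\times$ be the image of $\lambda$ under the reduction map $\mathbb Z_{p^s}\to\mathbb Z_{p^r}$, and let $t$ be the order of the image of $\lambda$ in $\mathbb Z_p^\times$. Let $\alpha,\alpha'$ be positive integers with $\alpha'\equiv\alpha\pmod t$ and $\gcd(\alpha,t)=1$. A $(\mathbb Z_{p^r},\mathbb Z_{p^s})$-additive $(\lambda',\lambda)$-constacyclic code of cycle length $(\alpha' n,\alpha n)$ (and of ratio $\alpha'/\alpha$), where $n\ge 1$, is a $\mathbb Z_{p^s}[X]$-submodule $C$ of $$\big(\mathbb Z_{p^r}[X]/\langle X^{\alpha' n}-\lambda'\rangle\big)\times\big(\mathbb Z_{p^s}[X]/\langle X^{\alpha n}-\lambda\rangle\big),$$ where $\mathbb Z_{p^s}[X]$ acts on the first factor through the reduction $\mathbb Z_{p^s}[X]\to\mathbb Z_{p^r}[X]$. Its length is $L(C)=\alpha' n r+\alpha n s$, its rate is $\mathrm R(C)=\log_p|C|/L(C)$,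 and its relative minimum distance is $\Delta(C)=\mathrm w(C)/L(C)$. Here $\mathrm w(C)$ is the minimum Hamming weight of the nonzero elements of $C$ (and $0$ if $C=0$), where the Hamming weight of a pair is the total number of nonzero coefficients in the representatives of degree less than $\alpha' n$ and less than $\alpha n$ of its two components. Then there are positive integers $n_1,n_2,\dots$ and, for each $i$, a $(\mathbb Z_{p^r},\mathbb Z_{p^s})$-additive $(\lambda',\lambda)$-constacyclic code $C_i$ of cycle length $(\alpha' n_i,\alpha n_i)$ such that the sequence $C_1,C_2,\dots$ is asymptotically good, that is, $L(C_i)\to\infty$ and there is a real number $\delta>0$ with $\mathrm R(C_i)\ge\delta$ and $\Delta(C_i)\ge\delta$ for all $i$. In particular (the case $\lambda=\lambda'=1$), for all positive integers $\alpha',\alpha$ there is such an asymptotically good sequence of $\mathbb Z_{p^r}\mathbb Z_{p^s}$-additive cyclic codes of ratio $\alpha'/\alpha$. -/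

import Mathlib

namespace DoubleConstacyclic

open Polynomial

/-- The quotient ring `R[X] / ⟨X ^ m - lam⟩`. -/
abbrev ConstacyclicQuotient {R : Type*} [CommRing R] (lam : R) (m : ℕ) : Type _ :=
  R[X] ⧸ Ideal.span {(X ^ m - C lam : R[X])}

/-- The Hamming weight on `R[X] / ⟨X ^ m - lam⟩`: the number of nonzero coefficients
`c_0, …, c_{m-1}` of the unique representative `c_0 + c_1 X + ⋯ + c_{m-1} X ^ (m-1)` of degree
less than `m`, that is, of the remainder of any representative modulo `X ^ m - lam`
(see `weight_mk`). -/
noncomputable def weight {R : Type*} [CommRing R] {lam : R} {m : ℕ}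
    (x : ConstacyclicQuotient lam m) : ℕ :=
  ((Quotient.out x : R[X]) %ₘ (X ^ m - C lam)).support.card

theorem weight_mk {R : Type*} [CommRing R] {lam : R} {m : ℕ} (hm : m ≠ 0) (f : R[X]) :
    weight (Ideal.Quotient.mk (Ideal.span {(X ^ m - C lam : R[X])}) f) =
      (f %ₘ (X ^ m - C lam)).support.card := by
  have hmonic : (X ^ m - C lam : R[X]).Monic := monic_X_pow_sub_C lam hm
  unfold weight
  congr 2
  set g := Quotient.out (Ideal.Quotient.mk (Ideal.span {(X ^ m - C lam : R[X])}) f) with hg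
  have h : Ideal.Quotient.mk (Ideal.span {(X ^ m - C lam : R[X])}) g =
      Ideal.Quotient.mk (Ideal.span {(X ^ m - C lam : R[X])}) f := Quotient.out_eq _
  rw [Ideal.Quotient.eq, Ideal.mem_span_singleton] at h
  have h2 := (modByMonic_eq_zero_iff_dvd hmonic).2 h
  rw [sub_modByMonic, sub_eq_zero] at h2
  exact h2

/-- `(R'[X] / ⟨X ^ m' - lam'⟩) × (R[X] / ⟨X ^ m - lam⟩)`, the space that contains the double
constacyclic codes of cycle length `(m', m)`. -/
def Ambient {R R' : Type*} [CommRing R] [CommRing R'] (_ρ : R →+* R') (lam' : R') (lam : R)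
    (m' m : ℕ) : Type _ :=
  ConstacyclicQuotient lam' m' × ConstacyclicQuotient lam m

noncomputable instance {R R' : Type*} [CommRing R] [CommRing R'] (ρ : R →+* R') (lam' : R') (lam : R)
    (m' m : ℕ) : AddCommGroup (Ambient ρ lam' lam m' m) :=
  inferInstanceAs (AddCommGroup (ConstacyclicQuotient lam' m' × ConstacyclicQuotient lam m))

/-- `R[X]` acts on the first factor through the map `R[X] → R'[X]` induced by `ρ`, and on the
second factor in the natural way (see `smul_fst`, `smul_snd`). -/
noncomputable instance {R R' : Type*} [CommRing R] [CommRing R'] (ρ : R →+* R') (lam' : R')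
    (lam : R) (m' m : ℕ) : Module R[X] (Ambient ρ lam' lam m' m) :=
  letI : Module R[X] (ConstacyclicQuotient lam' m') :=
    Module.compHom (ConstacyclicQuotient lam' m') (Polynomial.mapRingHom ρ)
  inferInstanceAs (Module R[X] (ConstacyclicQuotient lam' m' × ConstacyclicQuotient lam m))

theorem smul_fst {R R' : Type*} [CommRing R] [CommRing R'] {ρ : R →+* R'} {lam' : R'} {lam : R}
    {m' m : ℕ} (f : R[X]) (c : Ambient ρ lam' lam m' m) :
    (f • c).1 = Ideal.Quotient.mk _ (f.map ρ) * c.1 := by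
  exact Algebra.smul_def (f.map ρ) (show ConstacyclicQuotient lam' m' from c.1)

theorem smul_snd {R R' : Type*} [CommRing R] [CommRing R'] {ρ : R →+* R'} {lam' : R'} {lam : R}
    {m' m : ℕ} (f : R[X]) (c : Ambient ρ lam' lam m' m) :
    (f • c).2 = Ideal.Quotient.mk _ f * c.2 := by
  exact Algebra.smul_def f (show ConstacyclicQuotient lam m from c.2)

/-- The minimum Hamming weight of the nonzero codewords of `D` (which is the minimum distance of
`D`, as `D` is linear). It takes the value `0` if `D` has no nonzero codeword. -/
noncomputable def minWeight {R R' : Type*} [CommRing R] [CommRing R'] {ρ : R →+* R'} {lam' : R'}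
    {lam : R} {m' m : ℕ} (D : Submodule R[X] (Ambient ρ lam' lam m' m)) : ℕ :=
  sInf {w : ℕ | ∃ c ∈ D, c ≠ 0 ∧ w = weight c.1 + weight c.2}

/-- The class of `(ℤ_{p^r}, ℤ_{p^s})`-additive `(lam', lam)`-constacyclic codes of ratio `α' / α`:
such a code is a `ℤ_{p^s}[X]`-submodule of
`(ℤ_{p^r}[X] / ⟨X ^ (α' n) - lam'⟩) × (ℤ_{p^s}[X] / ⟨X ^ (α n) - lam⟩)` for some `n > 0`, where
`ℤ_{p^s}[X]` acts on the first factor through the reduction `ℤ_{p^s} → ℤ_{p^r}`. -/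
structure AdditiveConstacyclicCode (p r s : ℕ) (hrs : r ≤ s) (lam' : ZMod (p ^ r))
    (lam : ZMod (p ^ s)) (α' α : ℕ) where
  n : ℕ
  n_pos : 0 < n
  code : Submodule (ZMod (p ^ s))[X]
    (Ambient (ZMod.castHom (pow_dvd_pow p hrs) (ZMod (p ^ r))) lam' lam (α' * n) (α * n))

namespace AdditiveConstacyclicCode

variable {p r s : ℕ} {hrs : r ≤ s} {lam' : ZMod (p ^ r)} {lam : ZMod (p ^ s)} {α' α : ℕ}

/-- The code length `α' n ℓ' + α n ℓ`, where the nilpotency indices of the radicals of `ℤ_{p^r}`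
and `ℤ_{p^s}` are `ℓ' = r` and `ℓ = s`. -/
def length (D : AdditiveConstacyclicCode p r s hrs lam' lam α' α) : ℕ :=
  α' * D.n * r + α * D.n * s

/-- The rate `log_p |D| / length` (the residue field has `p` elements). -/
noncomputable def rate (D : AdditiveConstacyclicCode p r s hrs lam' lam α' α) : ℝ :=
  Real.logb p (Nat.card D.code) / D.length

/-- The relative minimum distance of a code, for the Hamming weight. -/
noncomputable def relMinDist (D : AdditiveConstacyclicCode p r s hrs lam' lam α' α) : ℝ :=
  minWeight D.code / D.length

/-- A sequence of codes is asymptotically good if the length goes to infinity and the rates and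
the relative minimum distances are bounded below by a common positive constant. -/
def IsAsymptoticallyGoodSeq (D : ℕ → AdditiveConstacyclicCode p r s hrs lam' lam α' α) : Prop :=
  Filter.Tendsto (fun i => (D i).length) Filter.atTop Filter.atTop ∧
    ∃ δ : ℝ, 0 < δ ∧ ∀ i, δ ≤ (D i).rate ∧ δ ≤ (D i).relMinDist

end AdditiveConstacyclicCode

/-- The `(ℤ_{p^r}, ℤ_{p^s})`-additive `(lam', lam)`-constacyclic codes of ratio `α' / α` are
asymptotically good: the class contains an asymptotically good sequence. -/
def AreAsymptoticallyGood (p r s : ℕ) (hrs : r ≤ s) (lam' : ZMod (p ^ r))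
    (lam : ZMod (p ^ s)) (α' α : ℕ) : Prop :=
  ∃ D : ℕ → AdditiveConstacyclicCode p r s hrs lam' lam α' α,
    AdditiveConstacyclicCode.IsAsymptoticallyGoodSeq D

end DoubleConstacyclic

/-! Let `μ` be the residue of `lam` in `ZMod p`. Choose a prime `q > p` with `q ≡ 1` mod `t`, an
inverse `m` of `α` mod `t`, and `n = m * q ^ k`. If `ζ` is a primitive `q ^ k`-th root of unity,
`μζ` is a root of both `X ^ (α' n) - μ` and `X ^ (α n) - μ`, and by lifting the exponent its minimal
polynomial `f` has degree `d` proportional to `n` (`exists_irreducible_dvd_X_pow_sub_C`).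

Put `g' = (X ^ (α' n) - μ) / f` and `g = (X ^ (α n) - μ) / f`. A word `(a g', a b g)` with `f ∤ a`
determines `b` mod `f`, so `p ^ d` choices of `b` cannot all yield a word in a Hamming ball with
fewer than `p ^ d` points (`exists_forall_le_card_support`). A ball of small enough linear radius is
that small (`exists_card_hammingBall_lt`). Multiplication by `p ^ (r - 1)` and `p ^ (s - 1)` carries
the code to the required rings without changing size or weights (`exists_code`). -/

namespace DoubleConstacyclic

open Polynomial

/-! ### Sizes of Hamming balls -/

section HammingBall

variable {ι F : Type*} [Fintype ι] [DecidableEq ι] [Fintype F] [DecidableEq F] [Zero F]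

theorem sum_pow_hammingNorm (x : ℝ) :
    ∑ v : ι → F, x ^ hammingNorm v = (∑ a : F, if a = 0 then 1 else x) ^ Fintype.card ι := by
  have h := Finset.prod_univ_sum (fun _ : ι => (Finset.univ : Finset F))
    (fun _ a => if a = 0 then (1 : ℝ) else x)
  simp only [Finset.prod_const, Fintype.piFinset_univ, Finset.card_univ] at h
  rw [h]
  refine Finset.sum_congr rfl fun v _ => ?_
  rw [Finset.prod_ite]
  simp [hammingNorm]

theorem sum_pow_hammingNorm_le {x : ℝ} (hx : 0 ≤ x) :
    ∑ v : ι → F, x ^ hammingNorm v ≤ Real.exp (Fintype.card F * x * Fintype.card ι) := by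
  rw [sum_pow_hammingNorm, mul_comm _ (Fintype.card ι : ℝ), Real.exp_nat_mul]
  have h0 : ∀ a : F, 0 ≤ (if a = 0 then 1 else x) := fun a => by split_ifs <;> positivity
  refine pow_le_pow_left₀ (Finset.sum_nonneg fun a _ => h0 a) ?_ _
  calc ∑ a : F, (if a = 0 then 1 else x) ≤ ∑ a : F, ((if a = 0 then 1 else 0) + x) :=
        Finset.sum_le_sum fun a _ => by split_ifs <;> linarith
    _ = Fintype.card F * x + 1 := by
        rw [Finset.sum_add_distrib]
        simp [add_comm]
    _ ≤ _ := Real.add_one_le_exp _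

/-- Chernoff bound: as `x ≤ 1`, each point of the ball contributes at least `x ^ w` to the weight
enumerator at `x`. -/
theorem card_hammingBall_mul_le {x : ℝ} (hx : 0 < x) (hx1 : x ≤ 1) (w : ℝ) :
    (Finset.univ.filter fun v : ι → F => (hammingNorm v : ℝ) < w).card * x ^ w ≤
      Real.exp (Fintype.card F * x * Fintype.card ι) := by
  refine le_trans ?_ (sum_pow_hammingNorm_le (ι := ι) (F := F) hx.le)
  rw [← nsmul_eq_mul]
  refine (Finset.card_nsmul_le_sum _ (fun v : ι → F => x ^ hammingNorm v) _ fun v hv => ?_).trans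
    (Finset.sum_le_sum_of_subset_of_nonneg (Finset.filter_subset _ _)
      fun v _ _ => by positivity)
  rw [← Real.rpow_natCast]
  exact Real.rpow_le_rpow_of_exponent_ge hx hx1 (Finset.mem_filter.1 hv).2.le

end HammingBall

theorem exists_card_hammingBall_lt (F : Type*) [Fintype F] [DecidableEq F] [Zero F] [Nontrivial F]
    {c : ℝ} (hc : 0 < c) :
    ∃ δ : ℝ, 0 < δ ∧ ∀ (ι : Type) [Fintype ι] [DecidableEq ι] [Nonempty ι] (d : ℕ), c * Fintype.card ι ≤ d →
      (Finset.univ.filter fun v : ι → F => (hammingNorm v : ℝ) < δ * Fintype.card ι).card <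
        Fintype.card F ^ d := by
  obtain ⟨q, hq⟩ : ∃ q : ℝ, q = Fintype.card F := ⟨_, rfl⟩
  have hq1 : 1 < q := by
    rw [hq]
    exact_mod_cast Fintype.one_lt_card (α := F)
  have hl : 0 < Real.log q := Real.log_pos hq1
  -- With `N` coordinates, the log of the ball size is at most `q x N - δ N log x`. The choices of
  -- `x` and `δ` make each term at most a third of `c N log q`; the `1 / 2` keeps `log x` negative.
  set x : ℝ := min (1 / 2) (c * Real.log q / (3 * q)) with hx
  have hx0 : 0 < x := by positivity
  have hx2 : x ≤ 1 / 2 := min_le_left _ _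
  have hxq : q * x ≤ c * Real.log q / 3 := by
    have := min_le_right (1 / 2) (c * Real.log q / (3 * q))
    rw [← hx, le_div_iff₀ (by positivity)] at this
    linarith
  have hlx : Real.log x < 0 := Real.log_neg hx0 (by linarith)
  refine ⟨c * Real.log q / (3 * -Real.log x), div_pos (by positivity) (by linarith), ?_⟩
  intro ι _ _ _ d hd
  set δ := c * Real.log q / (3 * -Real.log x) with hδ
  have hδx : δ * Real.log x = -(c * Real.log q / 3) := by
    have hne := hlx.ne
    rw [hδ, mul_neg, div_neg, neg_mul, div_mul_eq_mul_div, mul_div_mul_right _ _ hne]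
  have hN : (0 : ℝ) < Fintype.card ι := by exact_mod_cast Fintype.card_pos
  have h := card_hammingBall_mul_le (ι := ι) (F := F) hx0 (by linarith) (δ * Fintype.card ι)
  rw [← hq, Real.rpow_def_of_pos hx0, ← le_div_iff₀ (Real.exp_pos _), ← Real.exp_sub] at h
  have : ((Finset.univ.filter fun v : ι → F =>
      (hammingNorm v : ℝ) < δ * Fintype.card ι).card : ℝ) < q ^ d := by
    refine h.trans_lt ?_
    rw [← Real.exp_log (show 0 < q by linarith), ← Real.exp_nat_mul, Real.exp_log (by linarith),
      Real.exp_lt_exp]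
    have h1 := mul_le_mul_of_nonneg_right hxq hN.le
    have h2 := mul_le_mul_of_nonneg_right hd hl.le
    have h3 : Real.log x * (δ * Fintype.card ι) = -(c * Real.log q / 3) * Fintype.card ι := by
      rw [← hδx]; ring
    have : 0 < c * Real.log q * Fintype.card ι := by positivity
    rw [h3]
    linarith
  rw [hq] at this
  exact_mod_cast this

/-! ### Common irreducible factors of large degree -/

/-- The multiplicative order of `a` modulo `q ^ k` grows linearly in `q ^ k`. -/
theorem exists_prime_pow_le_mul_of_dvd {a q : ℕ} (ha : 1 < a) (hq : q.Prime) (hodd : Odd q)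
    (hqa : ¬ q ∣ a) :
    ∃ B : ℕ, 0 < B ∧ ∀ k d : ℕ, d ≠ 0 → q ^ k ∣ a ^ d - 1 → q ^ k ≤ B * d := by
  have := Fact.mk hq
  refine ⟨q ^ padicValNat q (a ^ (q - 1) - 1), pow_pos hq.pos _, fun k d hd h => ?_⟩
  have hq1 : q - 1 ≠ 0 := by have := hq.one_lt; omega
  have hlt : 1 < a ^ (q - 1) := Nat.one_lt_pow hq1 ha
  have hdvd : q ∣ a ^ (q - 1) - 1 := by
    rw [← Nat.totient_prime hq]
    exact (Nat.modEq_iff_dvd' (Nat.one_le_pow _ _ (by omega))).1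
      (Nat.ModEq.pow_totient ((hq.coprime_iff_not_dvd.2 hqa).symm)).symm
  -- Lifting the exponent needs a base congruent to `1` mod `q`, hence `a ^ (q - 1)` in place of
  -- `a`.
  have hval := padicValNat.pow_sub_pow hodd hlt hdvd (fun h => hqa (hq.dvd_of_dvd_pow h)) hd
  rw [one_pow, ← pow_mul] at hval
  have h2 : q ^ k ∣ a ^ ((q - 1) * d) - 1 :=
    h.trans (Nat.pow_sub_one_dvd_pow_sub_one a (Dvd.intro_left _ rfl))
  have hne : a ^ ((q - 1) * d) - 1 ≠ 0 := by
    have := Nat.one_lt_pow (Nat.mul_ne_zero hq1 hd) ha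
    omega
  rw [padicValNat_dvd_iff_le hne, hval] at h2
  calc q ^ k ≤ q ^ (padicValNat q (a ^ (q - 1) - 1) + padicValNat q d) :=
        Nat.pow_le_pow_right hq.pos h2
    _ = q ^ padicValNat q (a ^ (q - 1) - 1) * q ^ padicValNat q d := pow_add _ _ _
    _ ≤ _ := Nat.mul_le_mul_left _ (Nat.le_of_dvd (Nat.pos_of_ne_zero hd) pow_padicValNat_dvd)

theorem pow_eq_self_of_modEq_one {G : Type*} [Monoid G] {g : G} {m : ℕ}
    (h : m ≡ 1 [MOD orderOf g]) : g ^ m = g := by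
  rw [← pow_mod_orderOf, h, pow_mod_orderOf, pow_one]

/-- For infinitely many `n`, the polynomials `X ^ (α' n) - lam` and `X ^ (α n) - lam` have a common
irreducible factor whose degree is at least a fixed positive proportion of `n`. -/
theorem exists_irreducible_dvd_X_pow_sub_C (p : ℕ) [Fact p.Prime] (lam : (ZMod p)ˣ) {α' α : ℕ}
    (hα : 0 < α) (hmod : α' ≡ α [MOD orderOf lam]) (hcop : Nat.gcd α (orderOf lam) = 1) :
    ∃ c : ℝ, 0 < c ∧ ∀ i : ℕ, ∃ n : ℕ, 0 < n ∧ i ≤ n ∧ ∃ f : (ZMod p)[X], Irreducible f ∧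
      f ∣ X ^ (α' * n) - C (lam : ZMod p) ∧ f ∣ X ^ (α * n) - C (lam : ZMod p) ∧
      c * n ≤ f.natDegree := by
  have hp : p.Prime := Fact.out
  set t := orderOf lam with ht
  have ht0 : 0 < t := orderOf_pos lam
  obtain ⟨q, hq, hpq, hqt⟩ := Nat.exists_prime_gt_modEq_one p ht0.ne'
  have hqp : ¬ q ∣ p := fun h => absurd (Nat.le_of_dvd hp.pos h) (by omega)
  have hodd : Odd q := hq.odd_of_ne_two (by have := hp.two_le; omega)
  obtain ⟨B, hB, hBd⟩ := exists_prime_pow_le_mul_of_dvd hp.one_lt hq hodd hqp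
  set m := α ^ (t.totient - 1) with hm
  have hm0 : 0 < m := pow_pos hα _
  have hαm : α * m ≡ 1 [MOD t] := by
    rw [hm, ← pow_succ', Nat.sub_add_cancel (Nat.totient_pos.2 ht0)]
    exact Nat.ModEq.pow_totient hcop
  -- The constant comes from `n = m * q ^ k ≤ m * B * d`.
  refine ⟨1 / (m * B), by positivity, fun k => ?_⟩
  have hone : α * (m * q ^ k) ≡ 1 [MOD t] := by
    simpa [mul_assoc] using hαm.mul (hqt.pow k)
  have hone' : α' * (m * q ^ k) ≡ 1 [MOD t] := (hmod.mul_right _).trans hone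
  have hqK : ((q ^ k : ℕ) : AlgebraicClosure (ZMod p)) ≠ 0 := by
    rw [Ne, CharP.cast_eq_zero_iff _ p]
    intro h
    exact hqp (((Nat.prime_dvd_prime_iff_eq hp hq).1 (hp.dvd_of_dvd_pow h)) ▸ dvd_rfl)
  have : NeZero ((q ^ k : ℕ) : AlgebraicClosure (ZMod p)) := ⟨hqK⟩
  obtain ⟨ζ, hζ⟩ := HasEnoughRootsOfUnity.exists_primitiveRoot (AlgebraicClosure (ZMod p)) (q ^ k)
  set l : AlgebraicClosure (ZMod p) := algebraMap (ZMod p) _ (lam : ZMod p) with hl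
  have hl0 : l ≠ 0 := by simp [hl]
  have hint : IsIntegral (ZMod p) (l * ζ) := Algebra.IsIntegral.isIntegral _
  have hroot : ∀ a : ℕ, a * (m * q ^ k) ≡ 1 [MOD t] →
      minpoly (ZMod p) (l * ζ) ∣ X ^ (a * (m * q ^ k)) - C (lam : ZMod p) := by
    intro a ha
    have h1 : l ^ (a * (m * q ^ k)) = l := by
      rw [hl, ← map_pow, ← Units.val_pow_eq_pow_val, pow_eq_self_of_modEq_one ha]
    have h2 : ζ ^ (a * (m * q ^ k)) = 1 := by
      rw [← mul_assoc, mul_comm, pow_mul, hζ.pow_eq_one, one_pow]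
    refine minpoly.dvd _ _ ?_
    simp [mul_pow, h1, h2, ← hl]
  refine ⟨m * q ^ k, Nat.mul_pos hm0 (pow_pos hq.pos _), ?_, minpoly (ZMod p) (l * ζ),
    minpoly.irreducible hint, hroot α' hone', hroot α hone, ?_⟩
  · exact (Nat.lt_pow_self hq.one_lt).le.trans (Nat.le_mul_of_pos_left _ hm0)
  · set d := (minpoly (ZMod p) (l * ζ)).natDegree with hd
    have hd0 : d ≠ 0 := (minpoly.natDegree_pos hint).ne'
    -- `l * ζ` generates a field with `p ^ d` elements. As `l` lies in the prime field, `ζ` is fixed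
    -- by the same Frobenius power, so `q ^ k ∣ p ^ d - 1`.
    have hfix : (l * ζ) ^ p ^ d = l * ζ := by
      have : FiniteDimensional (ZMod p) (IntermediateField.adjoin (ZMod p) {l * ζ}) :=
        IntermediateField.adjoin.finiteDimensional hint
      have : Finite (IntermediateField.adjoin (ZMod p) {l * ζ}) := Module.finite_of_finite (ZMod p)
      let _ := Fintype.ofFinite (IntermediateField.adjoin (ZMod p) {l * ζ})
      have hcard := Module.card_eq_pow_finrank (K := ZMod p)
        (V := IntermediateField.adjoin (ZMod p) {l * ζ})
      rw [IntermediateField.adjoin.finrank hint, ← hd, ZMod.card] at hcard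
      have h := FiniteField.pow_card
        (⟨l * ζ, IntermediateField.mem_adjoin_simple_self _ _⟩ :
          IntermediateField.adjoin (ZMod p) {l * ζ})
      rw [hcard] at h
      exact congrArg Subtype.val h
    have hlfix : l ^ p ^ d = l := by
      rw [hl, ← map_pow, ZMod.pow_card_pow]
    have hdvd : q ^ k ∣ p ^ d - 1 := by
      rw [mul_pow, hlfix] at hfix
      have h := mul_left_cancel₀ hl0 hfix
      refine hζ.dvd_of_pow_eq_one _ (mul_left_cancel₀ (hζ.ne_zero (pow_pos hq.pos k).ne') ?_)
      rw [← pow_succ', Nat.sub_add_cancel (Nat.one_le_pow _ _ hp.pos), h, mul_one]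
    have hle : (q : ℝ) ^ k ≤ B * d := by exact_mod_cast hBd k d hd0 hdvd
    rw [div_mul_eq_mul_div, div_le_iff₀ (by positivity), one_mul]
    push_cast
    nlinarith [show (0 : ℝ) < m by exact_mod_cast hm0]

/-! ### Counting double codes over a finite field -/

theorem card_filter_coeff_ne_zero {F : Type*} [Semiring F] [DecidableEq F] {u : F[X]} {m : ℕ}
    (hu : u.degree < m) :
    (Finset.univ.filter fun i : Fin m => u.coeff i ≠ 0).card = u.support.card := by
  refine Finset.card_bij (fun i _ => (i : ℕ)) (by simp) (fun i _ j _ h => Fin.ext h) ?_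
  intro k hk
  have hkm : k < m := by
    by_contra h
    exact mem_support_iff.1 hk (coeff_eq_zero_of_degree_lt
      (hu.trans_le (by exact_mod_cast not_lt.1 h)))
  exact ⟨⟨k, hkm⟩, by simpa using hk, rfl⟩

/-- The vector of the first `m'` coefficients of `u'` followed by the first `m` coefficients
of `u`. -/
def coeffVector {F : Type*} [Semiring F] (m' m : ℕ) (u' u : F[X]) : Fin m' ⊕ Fin m → F :=
  Sum.elim (fun i => u'.coeff i) (fun i => u.coeff i)

theorem hammingNorm_coeffVector {F : Type*} [Semiring F] [DecidableEq F] {m' m : ℕ} {u' u : F[X]}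
    (hu' : u'.degree < m') (hu : u.degree < m) :
    hammingNorm (coeffVector m' m u' u) = u'.support.card + u.support.card := by
  rw [← card_filter_coeff_ne_zero hu', ← card_filter_coeff_ne_zero hu, hammingNorm,
    Finset.card_filter, Finset.card_filter, Finset.card_filter, Fintype.sum_sum_type]
  rfl

theorem eq_of_forall_coeff_eq {F : Type*} [Semiring F] {m : ℕ} {u v : F[X]}
    (hu : u.degree < m) (hv : v.degree < m) (h : ∀ i : Fin m, u.coeff i = v.coeff i) : u = v := by
  ext k
  by_cases hk : k < m
  · exact h ⟨k, hk⟩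
  · have hk' : (m : WithBot ℕ) ≤ k := by exact_mod_cast not_lt.1 hk
    rw [coeff_eq_zero_of_degree_lt (hu.trans_le hk'), coeff_eq_zero_of_degree_lt (hv.trans_le hk')]

theorem coeffVector_injective {F : Type*} [Semiring F] {m' m : ℕ} {u' u v' v : F[X]}
    (hu' : u'.degree < m') (hu : u.degree < m) (hv' : v'.degree < m') (hv : v.degree < m)
    (h : coeffVector m' m u' u = coeffVector m' m v' v) : u' = v' ∧ u = v :=
  ⟨eq_of_forall_coeff_eq hu' hv' fun i => congrFun h (Sum.inl i),
    eq_of_forall_coeff_eq hu hv fun i => congrFun h (Sum.inr i)⟩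

theorem modByMonic_eq_modByMonic_iff_dvd {R : Type*} [CommRing R] {P a b : R[X]} (hP : P.Monic) :
    a %ₘ P = b %ₘ P ↔ P ∣ a - b := by
  rw [← modByMonic_eq_zero_iff_dvd hP, sub_modByMonic, sub_eq_zero]

/-- If a Hamming ball has fewer than `q ^ deg f` elements, then one of the double codes
`{(a g', a b g) : a}` over the field with `q` elements has no nonzero codeword in that ball. -/
theorem exists_forall_le_card_support {F : Type*} [Field F] [Fintype F] [DecidableEq F]
    {f g' g P' P : F[X]} {m' m : ℕ} (hf : Irreducible f) (hP' : P'.Monic) (hP : P.Monic)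
    (hdeg' : P'.degree = m') (hdeg : P.degree = m) (hg' : P' = f * g') (hg : P = f * g) {w : ℝ}
    (hw : (Finset.univ.filter fun v : Fin m' ⊕ Fin m → F => (hammingNorm v : ℝ) < w).card <
      Fintype.card F ^ f.natDegree) :
    ∃ b : F[X], ∀ a : F[X], ¬ f ∣ a →
      w ≤ (((a * g') %ₘ P').support.card + ((a * (b * g)) %ₘ P).support.card : ℕ) := by
  by_contra! hcon
  choose a ha hlt using hcon
  have hd' : ∀ u : F[X], (u %ₘ P').degree < m' := fun u => hdeg' ▸ degree_modByMonic_lt u hP'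
  have hd : ∀ u : F[X], (u %ₘ P).degree < m := fun u => hdeg ▸ degree_modByMonic_lt u hP
  have hg0' : g' ≠ 0 := by rintro rfl; exact hP'.ne_zero (by simp [hg'])
  have hg0 : g ≠ 0 := by rintro rfl; exact hP.ne_zero (by simp [hg])
  -- It suffices to let `b` run over the residues mod `f`; `Φ` sends each to its light word.
  let poly : (Fin f.natDegree → F) → F[X] := fun x => (degreeLTEquiv F f.natDegree).symm x
  let Φ : (Fin f.natDegree → F) → (Fin m' ⊕ Fin m → F) := fun x =>
    coeffVector m' m ((a (poly x) * g') %ₘ P') ((a (poly x) * (poly x * g)) %ₘ P)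
  have hinj : Function.Injective Φ := by
    intro x y hxy
    obtain ⟨h1, h2⟩ := coeffVector_injective (hd' _) (hd _) (hd' _) (hd _) hxy
    rw [modByMonic_eq_modByMonic_iff_dvd hP', hg', ← sub_mul, mul_dvd_mul_iff_right hg0'] at h1
    rw [modByMonic_eq_modByMonic_iff_dvd hP, hg, ← mul_assoc, ← mul_assoc, ← sub_mul,
      mul_dvd_mul_iff_right hg0] at h2
    -- Equal words give `a(x) ≡ a(y)` and `a(x) x ≡ a(y) y` mod `f`; eliminate `a(y)`.
    have h3 : f ∣ a (poly x) * (poly x - poly y) := by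
      have := h2.sub (h1.mul_right (poly y))
      convert this using 1
      ring
    have h4 := (hf.prime.dvd_or_dvd h3).resolve_left (ha _)
    have hlt : (poly x - poly y).degree < f.degree := by
      rw [degree_eq_natDegree hf.ne_zero, ← mem_degreeLT]
      exact Submodule.sub_mem _ (Subtype.prop _) (Subtype.prop _)
    have h5 : poly x = poly y := sub_eq_zero.1 (eq_zero_of_dvd_of_degree_lt h4 hlt)
    exact (degreeLTEquiv F f.natDegree).symm.injective (Subtype.ext h5)
  refine absurd hw (not_lt.2 ?_)
  have hcard : Fintype.card F ^ f.natDegree =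
      (Finset.univ : Finset (Fin f.natDegree → F)).card := by simp
  rw [hcard]
  refine Finset.card_le_card_of_injOn Φ (fun x _ => ?_) hinj.injOn
  simpa [Φ, hammingNorm_coeffVector (hd' _) (hd _)] using hlt (poly x)

/-! ### Lifting from the residue field through the socle -/

section Socle

variable {p s : ℕ} [Fact p.Prime] (hs : s ≠ 0)

theorem pow_pred_mul_eq_zero_iff (x : ZMod (p ^ s)) :
    (p : ZMod (p ^ s)) ^ (s - 1) * x = 0 ↔ ZMod.castHom (dvd_pow_self p hs) (ZMod p) x = 0 := by
  have hp : p.Prime := Fact.out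
  have : NeZero (p ^ s) := ⟨pow_ne_zero _ hp.ne_zero⟩
  obtain ⟨k, rfl⟩ := ZMod.natCast_zmod_surjective x
  rw [map_natCast, ZMod.natCast_eq_zero_iff, ← Nat.cast_pow, ← Nat.cast_mul,
    ZMod.natCast_eq_zero_iff]
  obtain ⟨j, rfl⟩ := Nat.exists_eq_succ_of_ne_zero hs
  rw [Nat.succ_sub_one, pow_succ, mul_dvd_mul_iff_left (pow_ne_zero _ hp.ne_zero)]

/-- Division by a monic polynomial commutes with scalars and with reduction mod `p`, and `p ^ (s -
1)` kills exactly the coefficients that vanish mod `p`. -/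
theorem weight_mk_C_pow_pred_mul {m : ℕ} (hm : m ≠ 0) (lam : ZMod (p ^ s)) (h : (ZMod (p ^ s))[X]) :
    weight (Ideal.Quotient.mk (Ideal.span {(X ^ m - C lam : (ZMod (p ^ s))[X])})
      (C ((p : ZMod (p ^ s)) ^ (s - 1)) * h)) =
    (h.map (ZMod.castHom (dvd_pow_self p hs) (ZMod p)) %ₘ
      (X ^ m - C (ZMod.castHom (dvd_pow_self p hs) (ZMod p) lam))).support.card := by
  rw [weight_mk hm]
  have hmap := map_modByMonic (ZMod.castHom (dvd_pow_self p hs) (ZMod p)) (p := h)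
    (monic_X_pow_sub_C lam hm)
  rw [Polynomial.map_sub, Polynomial.map_pow, map_X, map_C] at hmap
  rw [← hmap, ← smul_eq_C_mul, smul_modByMonic]
  congr 1
  ext k
  rw [mem_support_iff, mem_support_iff, coeff_smul, coeff_map, smul_eq_mul, Ne, Ne,
    pow_pred_mul_eq_zero_iff hs]

end Socle

theorem weight_eq_zero_iff {R : Type*} [CommRing R] {lam : R} {m : ℕ} (hm : m ≠ 0)
    (x : ConstacyclicQuotient lam m) : weight x = 0 ↔ x = 0 := by
  obtain ⟨f, rfl⟩ := Ideal.Quotient.mk_surjective x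
  rw [weight_mk hm, Finset.card_eq_zero, support_eq_empty,
    modByMonic_eq_zero_iff_dvd (monic_X_pow_sub_C lam hm), Ideal.Quotient.eq_zero_iff_mem,
    Ideal.mem_span_singleton]

/-- `D ≠ ⊥` matters because the infimum of the empty set is `0`. -/
theorem le_minWeight {R R' : Type*} [CommRing R] [CommRing R'] {ρ : R →+* R'} {lam' : R'}
    {lam : R} {m' m : ℕ} {D : Submodule R[X] (Ambient ρ lam' lam m' m)} (hD : D ≠ ⊥) {w : ℝ}
    (h : ∀ c ∈ D, c ≠ 0 → w ≤ (weight c.1 + weight c.2 : ℕ)) : w ≤ minWeight D := by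
  obtain ⟨c, hc, hc0⟩ := Submodule.exists_mem_ne_zero_of_ne_bot hD
  obtain ⟨c, hc, hc0, he⟩ := Nat.sInf_mem
    (s := {w : ℕ | ∃ c ∈ D, c ≠ 0 ∧ w = weight c.1 + weight c.2}) ⟨_, c, hc, hc0, rfl⟩
  rw [minWeight, he]
  exact h c hc hc0

theorem Ambient.ext {R R' : Type*} [CommRing R] [CommRing R'] {ρ : R →+* R'} {lam' : R'}
    {lam : R} {m' m : ℕ} {x y : Ambient ρ lam' lam m' m} (h1 : x.1 = y.1) (h2 : x.2 = y.2) :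
    x = y :=
  Prod.ext h1 h2

/-- A common irreducible factor of `X ^ m' - μ` and `X ^ m - μ` of degree `d`, where `μ` is the
residue of `lam'` and `lam`, gives a double constacyclic code with `p ^ d` elements, all of them
multiples of `p ^ (r - 1)` and `p ^ (s - 1)`, and minimum weight at least `w`, if the Hamming ball
of radius `w` has fewer than `p ^ d` elements. -/
theorem exists_code {p r s : ℕ} [Fact p.Prime] (hr : 0 < r) (hrs : r ≤ s) {lam' : ZMod (p ^ r)}
    {lam : ZMod (p ^ s)} {μ : ZMod p} {m' m : ℕ} (hm' : m' ≠ 0) (hm : m ≠ 0)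
    (hlam' : ZMod.castHom (dvd_pow_self p hr.ne') (ZMod p) lam' = μ)
    (hlam : ZMod.castHom (dvd_pow_self p (hr.trans_le hrs).ne') (ZMod p) lam = μ)
    {f : (ZMod p)[X]} (hf : Irreducible f) (hf' : f ∣ X ^ m' - C μ) (hf2 : f ∣ X ^ m - C μ) {w : ℝ}
    (hw : (Finset.univ.filter fun v : Fin m' ⊕ Fin m → ZMod p => (hammingNorm v : ℝ) < w).card <
      p ^ f.natDegree) :
    ∃ D : Submodule (ZMod (p ^ s))[X]
        (Ambient (ZMod.castHom (pow_dvd_pow p hrs) (ZMod (p ^ r))) lam' lam m' m),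
      Nat.card D = p ^ f.natDegree ∧ w ≤ minWeight D := by
  have hs := (hr.trans_le hrs).ne'
  have hP' := monic_X_pow_sub_C μ hm'
  have hP := monic_X_pow_sub_C μ hm
  obtain ⟨g', hg'⟩ := hf'
  obtain ⟨g, hg⟩ := hf2
  have hg0' : g' ≠ 0 := by rintro rfl; exact hP'.ne_zero (by simp [hg'])
  obtain ⟨b, hb⟩ := exists_forall_le_card_support hf hP' hP
    (degree_X_pow_sub_C (Nat.pos_of_ne_zero hm') _) (degree_X_pow_sub_C (Nat.pos_of_ne_zero hm) _)
    hg' hg (by rwa [ZMod.card])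
  set ρ := ZMod.castHom (pow_dvd_pow p hrs) (ZMod (p ^ r)) with hρ
  set πr := ZMod.castHom (dvd_pow_self p hr.ne') (ZMod p) with hπr
  set πs := ZMod.castHom (dvd_pow_self p hs) (ZMod p) with hπs
  have hcomp : πr.comp ρ = πs := RingHom.ext_zmod _ _
  obtain ⟨G', hG'⟩ := map_surjective πr (ZMod.castHom_surjective _) g'
  have hsurj := map_surjective πs (ZMod.castHom_surjective _)
  obtain ⟨G, hG⟩ := hsurj (b * g)
  let v : Ambient ρ lam' lam m' m :=
    (Ideal.Quotient.mk _ (C ((p : ZMod (p ^ r)) ^ (r - 1)) * G'),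
      Ideal.Quotient.mk _ (C ((p : ZMod (p ^ s)) ^ (s - 1)) * G))
  have hw1 : ∀ a : (ZMod (p ^ s))[X], weight (a • v).1 = ((a.map πs * g') %ₘ (X ^ m' - C μ)).support.card := by
    intro a
    rw [smul_fst, ← map_mul, mul_left_comm, weight_mk_C_pow_pred_mul hr.ne' hm', ← hπr,
      Polynomial.map_mul, Polynomial.map_map, hcomp, hG', hlam']
  have hw2 : ∀ a : (ZMod (p ^ s))[X], weight (a • v).2 = ((a.map πs * (b * g)) %ₘ (X ^ m - C μ)).support.card := by
    intro a
    rw [smul_snd, ← map_mul, mul_left_comm, weight_mk_C_pow_pred_mul hs hm, ← hπs,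
      Polynomial.map_mul, hG, hlam]
  -- The span of `v` is thus a copy of `(ZMod p)[X] / ⟨f⟩`. The first component alone detects
  -- vanishing, since `f` might divide `b`.
  have hzero : ∀ a : (ZMod (p ^ s))[X], a • v = 0 ↔ f ∣ a.map πs := by
    intro a
    have h1 : (a • v).1 = 0 ↔ f ∣ a.map πs := by
      rw [← weight_eq_zero_iff hm', hw1, Finset.card_eq_zero, support_eq_empty,
        modByMonic_eq_zero_iff_dvd hP', hg', mul_dvd_mul_iff_right hg0']
    have h2 : f ∣ a.map πs → (a • v).2 = 0 := by
      intro h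
      rw [← weight_eq_zero_iff hm, hw2, Finset.card_eq_zero, support_eq_empty,
        modByMonic_eq_zero_iff_dvd hP, hg, ← mul_assoc]
      exact mul_dvd_mul_right (h.mul_right b) g
    exact ⟨fun h => h1.1 (congrArg Prod.fst h), fun h => Ambient.ext (h1.2 h) (h2 h)⟩
  refine ⟨Submodule.span _ {v}, ?_, le_minWeight ?_ ?_⟩
  · choose lift hlift using hsurj
    let poly : (Fin f.natDegree → ZMod p) → (ZMod p)[X] :=
      fun x => (degreeLTEquiv (ZMod p) f.natDegree).symm x
    let φ : (Fin f.natDegree → ZMod p) → Submodule.span (ZMod (p ^ s))[X] {v} :=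
      fun x => ⟨lift (poly x) • v, Submodule.smul_mem _ _ (Submodule.mem_span_singleton_self v)⟩
    have hφ : Function.Bijective φ := by
      constructor
      · intro x y hxy
        have h : lift (poly x) • v = lift (poly y) • v := congrArg Subtype.val hxy
        rw [← sub_eq_zero, ← sub_smul, hzero, Polynomial.map_sub, hlift, hlift] at h
        have hlt : (poly x - poly y).degree < f.degree := by
          rw [degree_eq_natDegree hf.ne_zero, ← mem_degreeLT]
          exact Submodule.sub_mem _ (Subtype.prop _) (Subtype.prop _)
        have h5 : poly x = poly y := sub_eq_zero.1 (eq_zero_of_dvd_of_degree_lt h hlt)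
        exact (degreeLTEquiv _ f.natDegree).symm.injective (Subtype.ext h5)
      · rintro ⟨c, hc⟩
        obtain ⟨a, rfl⟩ := Submodule.mem_span_singleton.1 hc
        have hmem : a.map πs % f ∈ degreeLT (ZMod p) f.natDegree := by
          rw [mem_degreeLT, ← degree_eq_natDegree hf.ne_zero]
          exact EuclideanDomain.mod_lt _ hf.ne_zero
        refine ⟨degreeLTEquiv _ _ ⟨_, hmem⟩, Subtype.ext ?_⟩
        change lift (poly _) • v = a • v
        rw [← sub_eq_zero, ← sub_smul, hzero, Polynomial.map_sub, hlift]
        simp only [poly, LinearEquiv.symm_apply_apply]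
        rw [EuclideanDomain.mod_eq_sub_mul_div, ← dvd_neg, neg_sub, sub_sub_cancel]
        exact dvd_mul_right _ _
    rw [← Nat.card_eq_of_bijective φ hφ]
    simp
  · rw [Ne, Submodule.span_singleton_eq_bot, ← one_smul (ZMod (p ^ s))[X] v, hzero,
      Polynomial.map_one]
    exact fun h => hf.not_isUnit (isUnit_of_dvd_one h)
  · intro c hc hc0
    obtain ⟨a, rfl⟩ := Submodule.mem_span_singleton.1 hc
    rw [hw1, hw2]
    exact hb _ fun h => hc0 ((hzero a).2 h)

/-! ### Asymptotically good sequences -/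

theorem areAsymptoticallyGood_of_modEq_orderOf {p : ℕ} [Fact p.Prime] {r s : ℕ} (hr : 0 < r)
    (hrs : r ≤ s) (lam : (ZMod (p ^ s))ˣ) {lam' : (ZMod (p ^ r))ˣ} {α' α : ℕ}
    (hlam' : lam' = ZMod.unitsMap (pow_dvd_pow p hrs) lam) (hα' : 0 < α') (hα : 0 < α)
    (hmod : α' ≡ α
      [MOD orderOf (ZMod.unitsMap (dvd_pow_self p (hr.trans_le hrs).ne') lam)])
    (hcop : Nat.gcd α
      (orderOf (ZMod.unitsMap (dvd_pow_self p (hr.trans_le hrs).ne') lam)) = 1) :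
    AreAsymptoticallyGood p r s hrs lam' lam α' α := by
  have hs := hr.trans_le hrs
  have hp : p.Prime := Fact.out
  set μ := ZMod.unitsMap (dvd_pow_self p hs.ne') lam with hμ
  have hlam : ZMod.castHom (dvd_pow_self p hs.ne') (ZMod p) (lam : ZMod (p ^ s)) = (μ : ZMod p) :=
    rfl
  have hlam'' : ZMod.castHom (dvd_pow_self p hr.ne') (ZMod p) (lam' : ZMod (p ^ r)) =
      (μ : ZMod p) := by
    rw [hlam', ← hlam]
    exact RingHom.congr_fun (RingHom.ext_zmod
      ((ZMod.castHom (dvd_pow_self p hr.ne') (ZMod p)).comp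
        (ZMod.castHom (pow_dvd_pow p hrs) (ZMod (p ^ r)))) _) (lam : ZMod (p ^ s))
  obtain ⟨c, hc, hn⟩ := exists_irreducible_dvd_X_pow_sub_C p μ hα hmod hcop
  have hsum : (0 : ℝ) < α' + α := by positivity
  -- There are `(α' + α) * n` coordinates, so the bound `c * n` on the degree is the proportion `c /
  -- (α' + α)` of them.
  obtain ⟨δ, hδ, hball⟩ := exists_card_hammingBall_lt (ZMod p) (div_pos hc hsum)
  have hLpos : (0 : ℝ) < α' * r + α * s := by positivity
  choose n hn0 hin f hf hf' hf2 hdeg using hn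
  have hcode : ∀ i, ∃ D : Submodule (Polynomial (ZMod (p ^ s)))
      (Ambient (ZMod.castHom (pow_dvd_pow p hrs) (ZMod (p ^ r))) (lam' : ZMod (p ^ r))
        (lam : ZMod (p ^ s)) (α' * n i) (α * n i)),
      Nat.card D = p ^ (f i).natDegree ∧ δ * ((α' + α) * n i) ≤ minWeight D := by
    intro i
    have hm' := (Nat.mul_pos hα' (hn0 i)).ne'
    have hm := (Nat.mul_pos hα (hn0 i)).ne'
    have hcard : (Fintype.card (Fin (α' * n i) ⊕ Fin (α * n i)) : ℝ) = (α' + α) * n i := by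
      simp [add_mul]
    have : Nonempty (Fin (α' * n i) ⊕ Fin (α * n i)) :=
      ⟨Sum.inl ⟨0, Nat.pos_of_ne_zero hm'⟩⟩
    have hb := hball (Fin (α' * n i) ⊕ Fin (α * n i)) (f i).natDegree (by
      rw [hcard, ← mul_assoc, div_mul_cancel₀ _ hsum.ne']
      exact hdeg i)
    rw [hcard, ZMod.card] at hb
    exact exists_code hr hrs hm' hm hlam'' hlam (hf i) (hf' i) (hf2 i) hb
  choose D hDcard hDw using hcode
  have hlength : ∀ i, ((α' * n i * r + α * n i * s : ℕ) : ℝ) = (α' * r + α * s) * n i := by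
    intro i
    push_cast
    ring
  refine ⟨fun i => ⟨n i, hn0 i, D i⟩, ?_, min (c / (α' * r + α * s))
    (δ * (α' + α) / (α' * r + α * s)), by positivity, fun i => ⟨?_, ?_⟩⟩
  · refine Filter.tendsto_atTop_mono (fun i => (hin i).trans ?_) Filter.tendsto_id
    refine le_trans ?_ (Nat.le_add_right _ _)
    exact (Nat.le_mul_of_pos_left _ hα').trans (Nat.le_mul_of_pos_right _ hr)
  · refine (min_le_left _ _).trans ?_
    have hn' : (0 : ℝ) < n i := by exact_mod_cast hn0 i
    simp only [AdditiveConstacyclicCode.rate, AdditiveConstacyclicCode.length]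
    rw [hDcard, hlength, Nat.cast_pow, Real.logb_pow, Real.logb_self_eq_one
      (by exact_mod_cast hp.one_lt), mul_one, div_le_div_iff₀ hLpos (by positivity)]
    nlinarith [hdeg i]
  · refine (min_le_right _ _).trans ?_
    have hn' : (0 : ℝ) < n i := by exact_mod_cast hn0 i
    simp only [AdditiveConstacyclicCode.relMinDist, AdditiveConstacyclicCode.length]
    rw [hlength, div_le_div_iff₀ hLpos (by positivity)]
    nlinarith [hDw i]

end DoubleConstacyclic

theorem corollary1p5 (p : ℕ) [Fact p.Prime] (r s : ℕ) (hr : 0 < r) (hrs : r ≤ s) :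
    (∀ (lam : (ZMod (p ^ s))ˣ) (lam' : (ZMod (p ^ r))ˣ) (t α' α : ℕ),
      lam' = ZMod.unitsMap (pow_dvd_pow p hrs) lam →
      t = orderOf (ZMod.unitsMap (dvd_pow_self p (hr.trans_le hrs).ne') lam) →
      0 < α' → 0 < α → α' ≡ α [MOD t] → Nat.gcd α t = 1 →
      DoubleConstacyclic.AreAsymptoticallyGood p r s hrs lam' lam α' α) ∧
    (∀ α' α : ℕ, 0 < α' → 0 < α →
      DoubleConstacyclic.AreAsymptoticallyGood p r s hrs 1 1 α' α) := by
  refine ⟨?_, fun α' α hα' hα => ?_⟩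
  · rintro lam lam' t α' α hlam' rfl hα' hα hmod hcop
    exact DoubleConstacyclic.areAsymptoticallyGood_of_modEq_orderOf hr hrs lam hlam' hα' hα hmod
      hcop
  · have h := DoubleConstacyclic.areAsymptoticallyGood_of_modEq_orderOf (p := p) hr hrs 1 (lam' := 1)
      (map_one _).symm hα' hα (by rw [map_one, orderOf_one]; exact Nat.modEq_one)
      (by rw [map_one, orderOf_one, Nat.gcd_one_right])
    simpa only [Units.val_one] using h
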